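/- Let $d\ge 2$ and let $w=(w_1,\dots,w_d)$ have strictly positive entries. Put $S_1=\sum_{i=1}^d w_i$, $S_2=\sum_{i=1}^d w_i^2$, $$l(w)=\tfrac1{12}\Big[\big(2\max_i w_i-S_1\big)_+\Big]^2,\qquad w_i^*=\begin{cases}w_i,&2w_i\le S_1,\\ S_1-w_i,&2w_i>S_1.\end{cases}$$ Let $F_1,\dots,F_d$ be continuous distribution functions on $\mathbb R$, let $C,C^*$ be $d$-variate copulas (distribution functions of random vectors with uniform$[0,1]$ marginals), and let $H=C(F_1,\dots,F_d)$ and $H^*=C^*(F_1,\dots,F_d)$ be the corresponding $d$-variate distribution functions. For a random vector $X=(X_1,\dots,X_d)$ with distribution function $H$, let $(X_i^c)_{i}=(F_i^{-1}(V))_{i}$ with $V$ uniform on $[0,1]$ and $F_i^{-1}(p)=\inf\{x: p\le F_i(x)\}$, and define $$\mathrm{SIX}(w,H)=\frac{\sum_{i<j}w_iw_j\,\rho_2(X_i,X_j)}{\sum_{i<j}w_iw_j\,\rho_2(X_i^c,X_j^c)},$$ where Spearman's rho is $$\rho_2(Y,Z)=3\big(P[(Y-Y')(Z-Z'')>0]-P[(Y-Y')(Z-Z'')<0]\big),$$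 with $(Y',Z')$, $(Y'',Z'')$ independent copies of $(Y,Z)$ (the three pairs being mutually independent). Write $C\prec C^*$ (concordance ordering) if $P(U\le x)\le P(U^*\le x)$ and $P(U>x)\le P(U^*>x)$ (componentwise inequalities) for all $x\in\mathbb R^d$, where $U,U^*$ have distribution functions $C,C^*$. Call $H$ comonotonic if $(x_i-y_i)(x_j-y_j)\ge0$ for all $i,j$ and all $x,y$ in the support of $H$. For $v\in(0,\infty)^d$ call $H$ $v$-CM if $P\big[\sum_i v_iF_i(X_i)=\tfrac12\sum_i v_i\big]=1$. Then SIX is the weighted average of the pairwise Spearman's rhos, $$\mathrm{SIX}(w,H)=\frac{\sum_{i<j}w_iw_j\,\rho_2(X_i,X_j)}{\sum_{i<j}w_iw_j},$$ and: (i) if $C\prec C^*$, then $\mathrm{SIX}(w,H)\le \mathrm{SIX}(w,H^*)$; (ii) $\displaystyle \frac{12\,l(w)-S_2}{S_1^2-S_2}\le \mathrm{SIX}(w,H)\le 1$; (iii) $\mathrm{SIX}(w,H)=1$ if and only if $H$ is comonotonic; (iv) $\displaystyle \mathrm{SIX}(w,H)=\frac{12\,l(w)-S_2}{S_1^2-S_2}$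 if and only if $H$ is $w^*$-CM. -/

import Mathlib

open MeasureTheory

namespace HerdBehavior

noncomputable section

/-- A `d`-variate distribution function is represented by the Borel measure on `ℝ^d` (the law of the
random vector) that it determines; this is its value `P(X₁ ≤ x₁, …, X_d ≤ x_d)`. -/
def jointCDF {d : ℕ} (H : Measure (Fin d → ℝ)) (x : Fin d → ℝ) : ℝ :=
  H.real {y | ∀ i, y i ≤ x i}

/-- The survival function `P(X₁ > x₁, …, X_d > x_d)`. -/
def jointSurvival {d : ℕ} (H : Measure (Fin d → ℝ)) (x : Fin d → ℝ) : ℝ :=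
  H.real {y | ∀ i, x i < y i}

/-- The law of the `i`-th coordinate. -/
def marginal {d : ℕ} (H : Measure (Fin d → ℝ)) (i : Fin d) : Measure ℝ :=
  H.map (fun x => x i)

/-- The Fréchet space of all `d`-variate laws with prescribed marginal laws. -/
def frechetSpace {d : ℕ} (ν : Fin d → Measure ℝ) : Set (Measure (Fin d → ℝ)) :=
  {H | IsProbabilityMeasure H ∧ ∀ i, marginal H i = ν i}

/-- The uniform law on `[0,1]`. -/
def uniform01 : Measure ℝ := (volume : Measure ℝ).restrict (Set.Icc 0 1)

/-- The `d`-variate copulas: the laws all of whose marginals are uniform on `[0,1]`. -/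
def copulas (d : ℕ) : Set (Measure (Fin d → ℝ)) :=
  frechetSpace (fun _ : Fin d => uniform01)

/-- `H = C(F₁, …, F_d)`, where `F i` is the distribution function of `ν i`. -/
def HasCopula {d : ℕ} (ν : Fin d → Measure ℝ) (H C : Measure (Fin d → ℝ)) : Prop :=
  ∀ x : Fin d → ℝ, jointCDF H x = jointCDF C (fun i => ProbabilityTheory.cdf (ν i) (x i))

/-- The concordance ordering `H ≺ H'`. -/
def ConcordanceLE {d : ℕ} (H H' : Measure (Fin d → ℝ)) : Prop :=
  (∀ x, jointCDF H x ≤ jointCDF H' x) ∧ ∀ x, jointSurvival H x ≤ jointSurvival H' x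

/-- Spearman's rho of the random variables `X` and `Y` on the probability space `(Ω, P)`. The two
independent copies of `(X, Y)` are realised on the threefold product of the probability space. -/
def spearmanRho {Ω : Type*} [MeasurableSpace Ω] (P : Measure Ω) (X Y : Ω → ℝ) : ℝ :=
  3 * ((P.prod (P.prod P)).real
        {ω : Ω × Ω × Ω | 0 < (X ω.1 - X ω.2.1) * (Y ω.1 - Y ω.2.2)}
      - (P.prod (P.prod P)).real
        {ω : Ω × Ω × Ω | (X ω.1 - X ω.2.1) * (Y ω.1 - Y ω.2.2) < 0})

/-- The quantile function `F⁻¹(p) = inf {x | p ≤ F(x)}` of a law on the line. -/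
def quantile (ν : Measure ℝ) (p : ℝ) : ℝ :=
  sInf {x : ℝ | p ≤ ProbabilityTheory.cdf ν x}

/-- Spearman's rho of the `i`-th and `j`-th coordinates of a random vector with law `H`. -/
def pairRho {d : ℕ} (H : Measure (Fin d → ℝ)) (i j : Fin d) : ℝ :=
  spearmanRho H (fun x => x i) (fun x => x j)

/-- Spearman's rho of the `i`-th and `j`-th coordinates of the comonotonic vector
`(F₁⁻¹(V), …, F_d⁻¹(V))`, `V` uniform on `[0,1]`, with the same marginals as `H`. -/
def comonotonicPairRho {d : ℕ} (H : Measure (Fin d → ℝ)) (i j : Fin d) : ℝ :=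
  spearmanRho uniform01 (quantile (marginal H i)) (quantile (marginal H j))

/-- The set of pairs of indices `i < j`. -/
def indexPairs (d : ℕ) : Finset (Fin d × Fin d) :=
  Finset.univ.filter (fun p => p.1 < p.2)

/-- The Spearman's rho type of the herd behavior index. -/
def six {d : ℕ} (w : Fin d → ℝ) (H : Measure (Fin d → ℝ)) : ℝ :=
  (∑ p ∈ indexPairs d, w p.1 * w p.2 * pairRho H p.1 p.2) /
    (∑ p ∈ indexPairs d, w p.1 * w p.2 * comonotonicPairRho H p.1 p.2)

/-- `H` is comonotonic: any two points of its (topological) support are ordered the same way in all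
coordinates. -/
def IsComonotonic {d : ℕ} (H : Measure (Fin d → ℝ)) : Prop :=
  ∀ x ∈ H.support, ∀ y ∈ H.support, ∀ i j, 0 ≤ (x i - y i) * (x j - y j)

/-- `H` is `w`-countermonotonic: `∑ wᵢ Fᵢ(Xᵢ) = (∑ wᵢ) / 2` with probability one. -/
def IsWeightedCM {d : ℕ} (w : Fin d → ℝ) (H : Measure (Fin d → ℝ)) : Prop :=
  H {x | ∑ i, w i * ProbabilityTheory.cdf (marginal H i) (x i) = (∑ i, w i) / 2} = 1

/-- The modified weight vector `w*`. -/
def wStar {d : ℕ} (w : Fin d → ℝ) (i : Fin d) : ℝ :=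
  if 2 * w i ≤ ∑ j, w j then w i else (∑ j, w j) - w i

/-- `l(w) = (1/12) [(2 max wᵢ - ∑ wᵢ)₊]²`. -/
def lowerVar {d : ℕ} (w : Fin d → ℝ) : ℝ :=
  1 / 12 * (max (2 * (⨆ i, w i) - ∑ i, w i) 0) ^ 2

end

end HerdBehavior

namespace HerdBehavior
open ProbabilityTheory

/-! Write Z_i = F_i(X_i) - 1/2, a centred uniform variable with variance 1/12 because F_i is
continuous. The sign of a product is the product of the signs, so integrating out the two
independent copies gives ρ₂(X_i, X_j) = 12 E[Z_i Z_j] (`spearmanRho_eq_integral`). For the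
comonotonic vector both ranks equal V, so every rho in the denominator is 1 and SIX is the weighted
average. Equivalently, (S₁² - S₂) SIX = 12 E[(∑ w_i Z_i)²] - S₂ (`six_eq_quadratic`).

Upper bound: E[(Z_i - Z_j)²] ≥ 0, with equality for all pairs iff the ranks agree almost surely,
which is comonotonicity (`isComonotonic_iff`).

Lower bound: let k carry a largest weight and a = (2w_k - S₁)₊, so that w = w* + a e_k. Then E[(∑
w_i Z_i)²] = E[(∑ w*_i Z_i)²] + 2a E[(∑ w*_i Z_i) Z_k] + a²/12 (`quadratic_eq_add`). The last term
is l(w), and the cross term is nonnegative (`excess_mul_nonneg`). Equality holds iff ∑ w*_i Z_i = 0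
almost surely, which also kills the cross term.

Monotonicity: Hoeffding's formula (`scoreCov_eq_integral_cdf`) makes E[Z_i Z_j] an increasing
function of the bivariate distribution function, which is a limit of values of the joint one. -/

instance : IsProbabilityMeasure uniform01 := ⟨by simp [uniform01]⟩

theorem marginal_isProbability {d : ℕ} (H : Measure (Fin d → ℝ)) [IsProbabilityMeasure H]
    (i : Fin d) : IsProbabilityMeasure (marginal H i) :=
  Measure.isProbabilityMeasure_map (measurable_pi_apply i).aemeasurable

/-- A law with continuous distribution function has no atoms. -/
theorem nullSingleton_of_continuous_cdf (μ : Measure ℝ) [IsProbabilityMeasure μ]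
    (hμ : Continuous (cdf μ)) : NullSingletonClass μ := by
  refine ⟨fun x => ?_⟩
  rw [← measure_cdf μ, StieltjesFunction.measure_singleton,
    (monotone_cdf μ).continuousWithinAt_Iio_iff_leftLim_eq.1 hμ.continuousAt.continuousWithinAt]
  simp

theorem measurable_cdf (μ : Measure ℝ) : Measurable (cdf μ) := (monotone_cdf μ).measurable

theorem abs_cdf_sub_half_le (μ : Measure ℝ) (x : ℝ) : |cdf μ x - 1 / 2| ≤ 1 := by
  have h0 := cdf_nonneg μ x
  have h1 := cdf_le_one μ x
  rw [abs_le]; constructor <;> linarith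

/-! ### Spearman's rho as a covariance of ranks -/

/-- The sign function, as a difference of two indicators. -/
noncomputable def signum (x : ℝ) : ℝ := (if 0 < x then 1 else 0) - (if x < 0 then 1 else 0)

theorem signum_mul (x y : ℝ) : signum (x * y) = signum x * signum y := by
  unfold signum
  rcases lt_trichotomy x 0 with hx | rfl | hx <;> rcases lt_trichotomy y 0 with hy | rfl | hy <;>
    simp [*, mul_pos_of_neg_of_neg, mul_neg_of_neg_of_pos, mul_neg_of_pos_of_neg,
      not_lt.2 (le_of_lt _)]

theorem measurable_signum : Measurable signum :=
  (Measurable.ite measurableSet_Ioi measurable_const measurable_const).sub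
    (Measurable.ite measurableSet_Iio measurable_const measurable_const)

theorem abs_signum_le (x : ℝ) : |signum x| ≤ 1 := by
  unfold signum
  split_ifs <;> simp

theorem integral_signum {Ω : Type*} [MeasurableSpace Ω] (P : Measure Ω) [IsFiniteMeasure P]
    {X : Ω → ℝ} (hX : Measurable X) :
    ∫ ω, signum (X ω) ∂P = P.real {ω | 0 < X ω} - P.real {ω | X ω < 0} := by
  have h1 : MeasurableSet {ω | 0 < X ω} := measurableSet_lt measurable_const hX
  have h2 : MeasurableSet {ω | X ω < 0} := measurableSet_lt hX measurable_const
  have e : (fun ω => signum (X ω)) = fun ω =>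
      {ω | 0 < X ω}.indicator (fun _ => (1 : ℝ)) ω - {ω | X ω < 0}.indicator (fun _ => (1 : ℝ)) ω := by
    funext ω
    simp [signum, Set.indicator_apply]
  rw [e, integral_sub ((integrable_const _).indicator h1) ((integrable_const _).indicator h2),
    integral_indicator_const _ h1, integral_indicator_const _ h2]
  simp

/-- P(X < t) - P(X > t) = 2F(t) - 1, since a continuous F puts no mass at t. -/
theorem integral_signum_sub {Ω : Type*} [MeasurableSpace Ω] (P : Measure Ω)
    [IsProbabilityMeasure P] {X : Ω → ℝ} (hX : Measurable X)
    (hc : Continuous (cdf (P.map X))) (t : ℝ) :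
    ∫ ω, signum (t - X ω) ∂P = 2 * (cdf (P.map X) t - 1 / 2) := by
  have : IsProbabilityMeasure (P.map X) := Measure.isProbabilityMeasure_map hX.aemeasurable
  have := nullSingleton_of_continuous_cdf _ hc
  rw [integral_signum P (hX.const_sub t)]
  have e1 : P.real {ω | 0 < t - X ω} = cdf (P.map X) t := by
    have hI : Set.Iic t =ᵐ[P.map X] Set.Iio t := Iio_ae_eq_Iic.symm
    rw [cdf_eq_real, measureReal_congr hI,
      map_measureReal_apply hX measurableSet_Iio]
    congr 1; ext ω; simp
  have e2 : P.real {ω | t - X ω < 0} = 1 - cdf (P.map X) t := by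
    rw [cdf_eq_real, ← probReal_compl_eq_one_sub measurableSet_Iic,
      map_measureReal_apply hX measurableSet_Iic.compl]
    congr 1; ext ω; simp
  rw [e1, e2]; ring

theorem spearmanRho_eq_integral {Ω : Type*} [MeasurableSpace Ω] (P : Measure Ω)
    [IsProbabilityMeasure P] {X Y : Ω → ℝ} (hX : Measurable X) (hY : Measurable Y)
    (hcX : Continuous (cdf (P.map X))) (hcY : Continuous (cdf (P.map Y))) :
    spearmanRho P X Y =
      12 * ∫ ω, (cdf (P.map X) (X ω) - 1 / 2) * (cdf (P.map Y) (Y ω) - 1 / 2) ∂P := by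
  have hm1 : Measurable fun ω : Ω × Ω × Ω => X ω.1 - X ω.2.1 := by fun_prop
  have hm2 : Measurable fun ω : Ω × Ω × Ω => Y ω.1 - Y ω.2.2 := by fun_prop
  unfold spearmanRho
  have hs := integral_signum (P.prod (P.prod P)) (hm1.mul hm2)
  simp only [Pi.mul_apply] at hs
  rw [← hs]
  simp only [signum_mul]
  rw [integral_prod]
  · have : ∀ x : Ω, ∫ y : Ω × Ω, signum (X x - X y.1) * signum (Y x - Y y.2) ∂(P.prod P) =
        4 * ((cdf (P.map X) (X x) - 1 / 2) * (cdf (P.map Y) (Y x) - 1 / 2)) := by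
      intro x
      rw [integral_prod_mul (fun y => signum (X x - X y)) (fun y => signum (Y x - Y y)),
        integral_signum_sub P hX hcX, integral_signum_sub P hY hcY]
      ring
    simp only [this]
    rw [integral_const_mul]; ring
  · refine Integrable.of_bound ((measurable_signum.comp hm1).mul
      (measurable_signum.comp hm2)).aestronglyMeasurable 1 (ae_of_all _ fun ω => ?_)
    simp only [Real.norm_eq_abs, abs_mul]
    exact mul_le_one₀ (abs_signum_le _) (abs_nonneg _) (abs_signum_le _)

/-- Lets the quantile functions, handled below as a.e. measurable for the uniform law, be replaced
by measurable versions. -/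
theorem spearmanRho_congr {Ω : Type*} [MeasurableSpace Ω] (P : Measure Ω)
    [IsProbabilityMeasure P] {X Y X' Y' : Ω → ℝ} (hX : X =ᵐ[P] X') (hY : Y =ᵐ[P] Y') :
    spearmanRho P X Y = spearmanRho P X' Y' := by
  have q1 : Measure.QuasiMeasurePreserving (fun ω : Ω × Ω × Ω => ω.1) (P.prod (P.prod P)) P :=
    Measure.quasiMeasurePreserving_fst
  have q2 : Measure.QuasiMeasurePreserving (fun ω : Ω × Ω × Ω => ω.2.1) (P.prod (P.prod P)) P :=
    Measure.quasiMeasurePreserving_fst.comp Measure.quasiMeasurePreserving_snd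
  have q3 : Measure.QuasiMeasurePreserving (fun ω : Ω × Ω × Ω => ω.2.2) (P.prod (P.prod P)) P :=
    Measure.quasiMeasurePreserving_snd.comp Measure.quasiMeasurePreserving_snd
  have h : ∀ᵐ ω ∂(P.prod (P.prod P)), (X ω.1 - X ω.2.1) * (Y ω.1 - Y ω.2.2) =
      (X' ω.1 - X' ω.2.1) * (Y' ω.1 - Y' ω.2.2) := by
    filter_upwards [q1.ae hX, q2.ae hX, q1.ae hY, q3.ae hY] with ω h1 h2 h3 h4
    rw [h1, h2, h3, h4]
  unfold spearmanRho
  congr 2 <;> refine measureReal_congr (Filter.eventuallyEq_set.2 ?_) <;>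
    filter_upwards [h] with ω hω <;> simp only [hω]

/-! ### Quantile and probability integral transforms -/

section Quantile

variable (ν : Measure ℝ)

/-- The endpoints are excluded: for p = 0 the set under the infimum is unbounded below, for p = 1 it
may be empty, and `sInf` then takes the default value 0. -/
theorem quantile_le_iff {p x : ℝ} (h0 : 0 < p) (h1 : p < 1) :
    quantile ν p ≤ x ↔ p ≤ cdf ν x := by
  have hbdd : BddBelow {x : ℝ | p ≤ cdf ν x} := by
    obtain ⟨b, hb⟩ := ((tendsto_cdf_atBot ν).eventually (gt_mem_nhds h0)).exists
    refine ⟨b, fun y hy => le_of_lt ?_⟩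
    by_contra hlt
    exact absurd (hy.trans (monotone_cdf ν (not_lt.1 hlt))) (not_le.2 hb)
  have hne : {x : ℝ | p ≤ cdf ν x}.Nonempty := by
    obtain ⟨b, hb⟩ := ((tendsto_cdf_atTop ν).eventually (lt_mem_nhds h1)).exists
    exact ⟨b, hb.le⟩
  constructor
  · intro h
    have hr : Filter.Tendsto (cdf ν) (nhdsWithin x (Set.Ioi x)) (nhds (cdf ν x)) :=
      ((cdf ν).right_continuous x).mono Set.Ioi_subset_Ici_self
    refine ge_of_tendsto hr (Filter.mem_of_superset self_mem_nhdsWithin fun y hy => ?_)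
    obtain ⟨z, hz, hzy⟩ := exists_lt_of_csInf_lt hne (lt_of_le_of_lt h hy)
    exact le_trans (show p ≤ cdf ν z from hz) (monotone_cdf ν hzy.le)
  · intro h
    exact csInf_le hbdd h

theorem cdf_quantile (hν : Continuous (cdf ν)) {p : ℝ} (h0 : 0 < p) (h1 : p < 1) :
    cdf ν (quantile ν p) = p := by
  refine le_antisymm ?_ ((quantile_le_iff ν h0 h1).1 le_rfl)
  -- To the left of the quantile F < p, so the left limit, which is F at the quantile by continuity,
  -- is at most p.
  have hl : Filter.Tendsto (cdf ν) (nhdsWithin (quantile ν p) (Set.Iio (quantile ν p)))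
      (nhds (cdf ν (quantile ν p))) := hν.continuousAt.tendsto.mono_left nhdsWithin_le_nhds
  refine le_of_tendsto hl (Filter.mem_of_superset self_mem_nhdsWithin fun y hy => ?_)
  exact le_of_lt (not_le.1 fun h => not_le.2 hy ((quantile_le_iff ν h0 h1).2 h))

theorem uniform01_eq_restrict_Ioo : uniform01 = volume.restrict (Set.Ioo (0 : ℝ) 1) :=
  (Measure.restrict_congr_set Ioo_ae_eq_Icc).symm

theorem ae_uniform01_mem_Ioo : ∀ᵐ p ∂uniform01, p ∈ Set.Ioo (0 : ℝ) 1 := by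
  rw [uniform01_eq_restrict_Ioo]
  exact ae_restrict_mem measurableSet_Ioo

theorem aemeasurable_quantile : AEMeasurable (quantile ν) uniform01 := by
  rw [uniform01_eq_restrict_Ioo]
  refine aemeasurable_restrict_of_monotoneOn measurableSet_Ioo fun p hp q hq hpq => ?_
  exact (quantile_le_iff ν hp.1 hp.2).2 (hpq.trans ((quantile_le_iff ν hq.1 hq.2).1 le_rfl))

/-- The quantile transform of a uniform variable has the prescribed law. -/
theorem map_quantile [IsProbabilityMeasure ν] : uniform01.map (quantile ν) = ν := by
  have hq := aemeasurable_quantile ν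
  have : IsProbabilityMeasure (uniform01.map (quantile ν)) := Measure.isProbabilityMeasure_map hq
  refine Measure.eq_of_cdf _ _ (StieltjesFunction.ext fun x => ?_)
  rw [cdf_eq_real, measureReal_def, Measure.map_apply_of_aemeasurable hq measurableSet_Iic]
  have h : (quantile ν ⁻¹' Set.Iic x : Set ℝ) =ᵐ[uniform01] Set.Iic (cdf ν x) := by
    refine Filter.eventuallyEq_set.2 ?_
    filter_upwards [ae_uniform01_mem_Ioo] with p hp
    exact quantile_le_iff ν hp.1 hp.2
  rw [measure_congr h, uniform01, Measure.restrict_apply measurableSet_Iic, Set.inter_comm]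
  have e : Set.Icc (0 : ℝ) 1 ∩ Set.Iic (cdf ν x) = Set.Icc 0 (cdf ν x) := by
    ext p
    simp only [Set.mem_inter_iff, Set.mem_Icc, Set.mem_Iic]
    have := cdf_le_one ν x
    constructor
    · rintro ⟨⟨a, b⟩, c⟩; exact ⟨a, c⟩
    · rintro ⟨a, b⟩; exact ⟨⟨a, b.trans this⟩, b⟩
  rw [e, Real.volume_Icc, sub_zero, ENNReal.toReal_ofReal (cdf_nonneg ν x)]

/-- The probability integral transform. -/
theorem map_cdf_eq_uniform01 [IsProbabilityMeasure ν] (hν : Continuous (cdf ν)) : ν.map (cdf ν) = uniform01 := by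
  have h := AEMeasurable.map_map_of_aemeasurable (μ := uniform01) (f := quantile ν) (g := cdf ν)
    (measurable_cdf ν).aemeasurable (aemeasurable_quantile ν)
  rw [map_quantile ν] at h
  rw [h]
  conv_rhs => rw [← Measure.map_id (μ := uniform01)]
  refine Measure.map_congr ?_
  filter_upwards [ae_uniform01_mem_Ioo] with p hp
  exact cdf_quantile ν hν hp.1 hp.2

end Quantile

/-! ### Uniform moments and the comonotonic rho -/

theorem integral_uniform01_sub_half : ∫ p, (p - 1 / 2) ∂uniform01 = 0 := by
  rw [uniform01, integral_Icc_eq_integral_Ioc, ← intervalIntegral.integral_of_le zero_le_one]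
  norm_num [integral_id]

theorem integral_uniform01_sub_half_sq : ∫ p, (p - 1 / 2) * (p - 1 / 2) ∂uniform01 = 1 / 12 := by
  rw [uniform01, integral_Icc_eq_integral_Ioc, ← intervalIntegral.integral_of_le zero_le_one]
  have h : ∀ p : ℝ, (p - 1 / 2) * (p - 1 / 2) = p ^ 2 - p + 1 / 4 := fun p => by ring
  simp only [h]
  rw [intervalIntegral.integral_add, intervalIntegral.integral_sub] <;>
    first
    | (apply Continuous.intervalIntegrable; fun_prop)
    | norm_num [integral_id, integral_pow]

theorem comonotonicPairRho_eq_one {d : ℕ} (H : Measure (Fin d → ℝ)) [IsProbabilityMeasure H]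
    (hc : ∀ i, Continuous (cdf (marginal H i))) (i j : Fin d) :
    comonotonicPairRho H i j = 1 := by
  have := marginal_isProbability H
  have hi := aemeasurable_quantile (marginal H i)
  have hj := aemeasurable_quantile (marginal H j)
  have mi : uniform01.map (hi.mk _) = marginal H i :=
    (Measure.map_congr hi.ae_eq_mk).symm.trans (map_quantile _)
  have mj : uniform01.map (hj.mk _) = marginal H j :=
    (Measure.map_congr hj.ae_eq_mk).symm.trans (map_quantile _)
  rw [comonotonicPairRho, spearmanRho_congr _ hi.ae_eq_mk hj.ae_eq_mk,
    spearmanRho_eq_integral _ hi.measurable_mk hj.measurable_mk (by rw [mi]; exact hc i)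
      (by rw [mj]; exact hc j), mi, mj]
  have e : ∫ ω, (cdf (marginal H i) (hi.mk _ ω) - 1 / 2) * (cdf (marginal H j) (hj.mk _ ω) - 1 / 2)
      ∂uniform01 = ∫ p, (p - 1 / 2) * (p - 1 / 2) ∂uniform01 := by
    refine integral_congr_ae ?_
    filter_upwards [ae_uniform01_mem_Ioo, hi.ae_eq_mk, hj.ae_eq_mk] with p hp h1 h2
    rw [← h1, ← h2, cdf_quantile _ (hc i) hp.1 hp.2, cdf_quantile _ (hc j) hp.1 hp.2]
  rw [e, integral_uniform01_sub_half_sq]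
  norm_num

/-- The centred rank `F_i(x_i) - 1/2` of the `i`-th coordinate. -/
noncomputable def rankScore {d : ℕ} (H : Measure (Fin d → ℝ)) (i : Fin d) (x : Fin d → ℝ) : ℝ :=
  cdf (marginal H i) (x i) - 1 / 2

theorem measurable_cdf_coord {d : ℕ} (H : Measure (Fin d → ℝ)) (i : Fin d) :
    Measurable fun x : Fin d → ℝ => cdf (marginal H i) (x i) :=
  (measurable_cdf _).comp (measurable_pi_apply i)

/-- The covariance of the centred ranks. -/
noncomputable def scoreCov {d : ℕ} (H : Measure (Fin d → ℝ)) (i j : Fin d) : ℝ :=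
  ∫ x, rankScore H i x * rankScore H j x ∂H

/-! ### Second moments of the centred ranks -/

section RankScore

variable {d : ℕ} (H : Measure (Fin d → ℝ))

theorem measurable_rankScore (i : Fin d) : Measurable (rankScore H i) :=
  (measurable_cdf_coord H i).sub_const _

theorem abs_rankScore_le (i : Fin d) (x : Fin d → ℝ) : |rankScore H i x| ≤ 1 :=
  abs_cdf_sub_half_le _ _

theorem scoreCov_comm (i j : Fin d) : scoreCov H i j = scoreCov H j i := by
  simp only [scoreCov, mul_comm]

variable [IsProbabilityMeasure H]

theorem integrable_rankScore (i : Fin d) : Integrable (rankScore H i) H :=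
  Integrable.of_bound (measurable_rankScore H i).aestronglyMeasurable 1
    (ae_of_all _ fun x => abs_rankScore_le H i x)

theorem integrable_rankScore_mul (i j : Fin d) :
    Integrable (fun x => rankScore H i x * rankScore H j x) H :=
  Integrable.of_bound ((measurable_rankScore H i).mul (measurable_rankScore H j)).aestronglyMeasurable
    1 (ae_of_all _ fun x => by
      rw [Real.norm_eq_abs, abs_mul]
      exact mul_le_one₀ (abs_rankScore_le H i x) (abs_nonneg _) (abs_rankScore_le H j x))

theorem pairRho_eq_scoreCov (hc : ∀ i, Continuous (cdf (marginal H i))) (i j : Fin d) :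
    pairRho H i j = 12 * scoreCov H i j :=
  spearmanRho_eq_integral H (measurable_pi_apply i) (measurable_pi_apply j) (hc i) (hc j)

theorem map_cdf_coord (hc : ∀ i, Continuous (cdf (marginal H i))) (i : Fin d) :
    H.map (fun x => cdf (marginal H i) (x i)) = uniform01 := by
  have := marginal_isProbability H i
  have h := Measure.map_map (μ := H) (measurable_cdf (marginal H i)) (measurable_pi_apply i)
  rw [← map_cdf_eq_uniform01 (marginal H i) (hc i)]
  exact h.symm

theorem integral_comp_cdf_coord (hc : ∀ i, Continuous (cdf (marginal H i))) (i : Fin d)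
    {g : ℝ → ℝ} (hg : Measurable g) :
    ∫ x, g (cdf (marginal H i) (x i)) ∂H = ∫ p, g p ∂uniform01 := by
  rw [← map_cdf_coord H hc i, integral_map (measurable_cdf_coord H i).aemeasurable
    hg.aestronglyMeasurable]

theorem integral_rankScore (hc : ∀ i, Continuous (cdf (marginal H i))) (i : Fin d) :
    ∫ x, rankScore H i x ∂H = 0 :=
  (integral_comp_cdf_coord H hc i (g := fun p => p - 1 / 2) (by fun_prop)).trans
    integral_uniform01_sub_half

theorem scoreCov_self (hc : ∀ i, Continuous (cdf (marginal H i))) (i : Fin d) :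
    scoreCov H i i = 1 / 12 :=
  (integral_comp_cdf_coord H hc i (g := fun p => (p - 1 / 2) * (p - 1 / 2)) (by fun_prop)).trans
    integral_uniform01_sub_half_sq

theorem ae_cdf_coord_ne (hc : ∀ i, Continuous (cdf (marginal H i))) (i : Fin d) (c : ℝ) :
    ∀ᵐ x ∂H, cdf (marginal H i) (x i) ≠ c := by
  have h : H ((fun x : Fin d → ℝ => cdf (marginal H i) (x i)) ⁻¹' {c}) = 0 := by
    rw [← Measure.map_apply (measurable_cdf_coord H i) (measurableSet_singleton c), map_cdf_coord H hc i, uniform01]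
    simp
  exact (measure_eq_zero_iff_ae_notMem.1 h)

theorem integrable_sum_mul_sum (a b : Fin d → ℝ) :
    Integrable (fun x => (∑ i, a i * rankScore H i x) * ∑ j, b j * rankScore H j x) H := by
  have e : (fun x => (∑ i, a i * rankScore H i x) * ∑ j, b j * rankScore H j x) =
      fun x => ∑ i, ∑ j, a i * b j * (rankScore H i x * rankScore H j x) := by
    funext x
    rw [Finset.sum_mul_sum]
    exact Finset.sum_congr rfl fun i _ => Finset.sum_congr rfl fun j _ => by ring
  rw [e]
  exact integrable_finsetSum _ fun i _ => integrable_finsetSum _ fun j _ =>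
    (integrable_rankScore_mul H i j).const_mul _

theorem integral_sum_mul_sum (a b : Fin d → ℝ) :
    ∫ x, (∑ i, a i * rankScore H i x) * (∑ j, b j * rankScore H j x) ∂H =
      ∑ i, ∑ j, a i * b j * scoreCov H i j := by
  have e : (fun x => (∑ i, a i * rankScore H i x) * ∑ j, b j * rankScore H j x) =
      fun x => ∑ i, ∑ j, a i * b j * (rankScore H i x * rankScore H j x) := by
    funext x
    rw [Finset.sum_mul_sum]
    exact Finset.sum_congr rfl fun i _ => Finset.sum_congr rfl fun j _ => by ring
  rw [e, integral_finsetSum _ fun i _ => integrable_finsetSum _ fun j _ =>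
    (integrable_rankScore_mul H i j).const_mul _]
  refine Finset.sum_congr rfl fun i _ => ?_
  rw [integral_finsetSum _ fun j _ => (integrable_rankScore_mul H i j).const_mul _]
  exact Finset.sum_congr rfl fun j _ => integral_const_mul _ _

theorem integral_rankScore_sub_sq (hc : ∀ i, Continuous (cdf (marginal H i))) (i j : Fin d) :
    ∫ x, (rankScore H i x - rankScore H j x) ^ 2 ∂H = 1 / 6 - 2 * scoreCov H i j := by
  have e : ∀ x, (rankScore H i x - rankScore H j x) ^ 2 = rankScore H i x * rankScore H i x +
      rankScore H j x * rankScore H j x - 2 * (rankScore H i x * rankScore H j x) :=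
    fun x => by ring
  have hi := integrable_rankScore_mul H
  simp only [e]
  have hij : Integrable (fun x => rankScore H i x * rankScore H i x +
      rankScore H j x * rankScore H j x) H := (hi i i).add (hi j j)
  rw [integral_sub hij ((hi i j).const_mul 2), integral_add (hi i i) (hi j j),
    integral_const_mul]
  change scoreCov H i i + scoreCov H j j - 2 * scoreCov H i j = _
  rw [scoreCov_self H hc, scoreCov_self H hc]
  ring

theorem integral_rankScore_add_sq (hc : ∀ i, Continuous (cdf (marginal H i))) (i j : Fin d) :
    ∫ x, (rankScore H i x + rankScore H j x) ^ 2 ∂H = 1 / 6 + 2 * scoreCov H i j := by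
  have e : ∀ x, (rankScore H i x + rankScore H j x) ^ 2 = rankScore H i x * rankScore H i x +
      rankScore H j x * rankScore H j x + 2 * (rankScore H i x * rankScore H j x) :=
    fun x => by ring
  have hi := integrable_rankScore_mul H
  simp only [e]
  have hij : Integrable (fun x => rankScore H i x * rankScore H i x +
      rankScore H j x * rankScore H j x) H := (hi i i).add (hi j j)
  rw [integral_add hij ((hi i j).const_mul 2), integral_add (hi i i) (hi j j),
    integral_const_mul]
  change scoreCov H i i + scoreCov H j j + 2 * scoreCov H i j = _
  rw [scoreCov_self H hc, scoreCov_self H hc]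
  ring

theorem scoreCov_le (hc : ∀ i, Continuous (cdf (marginal H i))) (i j : Fin d) :
    scoreCov H i j ≤ 1 / 12 := by
  have h := integral_rankScore_sub_sq H hc i j
  have h0 : 0 ≤ ∫ x, (rankScore H i x - rankScore H j x) ^ 2 ∂H :=
    integral_nonneg fun x => sq_nonneg _
  linarith

theorem neg_le_scoreCov (hc : ∀ i, Continuous (cdf (marginal H i))) (i j : Fin d) :
    -(1 / 12) ≤ scoreCov H i j := by
  have h := integral_rankScore_add_sq H hc i j
  have h0 : 0 ≤ ∫ x, (rankScore H i x + rankScore H j x) ^ 2 ∂H :=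
    integral_nonneg fun x => sq_nonneg _
  linarith

theorem scoreCov_eq_iff (hc : ∀ i, Continuous (cdf (marginal H i))) (i j : Fin d) :
    scoreCov H i j = 1 / 12 ↔
      ∀ᵐ x ∂H, cdf (marginal H i) (x i) = cdf (marginal H j) (x j) := by
  have hint : Integrable (fun x => (rankScore H i x - rankScore H j x) ^ 2) H := by
    have e : ∀ x, (rankScore H i x - rankScore H j x) ^ 2 = rankScore H i x * rankScore H i x +
        rankScore H j x * rankScore H j x - 2 * (rankScore H i x * rankScore H j x) :=
      fun x => by ring
    simp only [e]
    exact ((integrable_rankScore_mul H i i).add (integrable_rankScore_mul H j j)).sub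
      ((integrable_rankScore_mul H i j).const_mul 2)
  have h := integral_rankScore_sub_sq H hc i j
  have hz := integral_eq_zero_iff_of_nonneg (fun x => sq_nonneg _) hint
  have hiff : scoreCov H i j = 1 / 12 ↔
      ∫ x, (rankScore H i x - rankScore H j x) ^ 2 ∂H = 0 := by
    rw [h]; constructor <;> intro h' <;> linarith
  rw [hiff, hz]
  refine Filter.eventually_congr (ae_of_all _ fun x => ?_)
  simp only [Pi.zero_apply, rankScore, sq_eq_zero_iff, sub_eq_zero, sub_left_inj]

end RankScore

/-! ### Sums over pairs and the modified weights -/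

section Combinatorics

variable {d : ℕ}

theorem sum_sum_eq_diag_add_indexPairs (g : Fin d → Fin d → ℝ) (hg : ∀ i j, g i j = g j i) :
    ∑ i, ∑ j, g i j = ∑ i, g i i + 2 * ∑ p ∈ indexPairs d, g p.1 p.2 := by
  have h1 : ∑ p ∈ indexPairs d, g p.1 p.2 = ∑ i, ∑ j, if i < j then g i j else 0 := by
    rw [indexPairs, Finset.sum_filter, ← Finset.univ_product_univ, Finset.sum_product]
  have h2 : ∑ i, ∑ j, (if j < i then g i j else 0) = ∑ i, ∑ j, if i < j then g i j else 0 := by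
    rw [Finset.sum_comm]
    simp only [hg]
  have h3 : ∀ i j, g i j = (if i = j then g i i else 0) +
      ((if i < j then g i j else 0) + if j < i then g i j else 0) := by
    intro i j
    rcases lt_trichotomy i j with h | rfl | h
    · simp [h, h.ne, h.not_gt]
    · simp
    · simp [h, h.ne', h.not_gt]
  calc ∑ i, ∑ j, g i j = ∑ i, ∑ j, ((if i = j then g i i else 0) +
      ((if i < j then g i j else 0) + if j < i then g i j else 0)) :=
        Finset.sum_congr rfl fun i _ => Finset.sum_congr rfl fun j _ => h3 i j
    _ = _ := by
        simp only [Finset.sum_add_distrib, h2, ← h1, Finset.sum_ite_eq, Finset.mem_univ, if_true]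
        ring

theorem two_mul_sum_indexPairs (w : Fin d → ℝ) :
    2 * ∑ p ∈ indexPairs d, w p.1 * w p.2 = (∑ i, w i) ^ 2 - ∑ i, w i ^ 2 := by
  have h := sum_sum_eq_diag_add_indexPairs (fun i j => w i * w j) fun i j => mul_comm _ _
  rw [← Finset.sum_mul_sum] at h
  simp only [pow_two]
  linarith

theorem sum_indexPairs_pos (hd : 2 ≤ d) {w : Fin d → ℝ} (hw : ∀ i, 0 < w i) :
    0 < ∑ p ∈ indexPairs d, w p.1 * w p.2 :=
  Finset.sum_pos (fun p _ => mul_pos (hw _) (hw _))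
    ⟨(⟨0, by omega⟩, ⟨1, by omega⟩), by simp [indexPairs]⟩

/-- The weights `w - a e_k` with `k` a largest weight and `a = (2 w_k - ∑ w)₊` are `w*`. -/
theorem wStar_eq_sub {w : Fin d → ℝ} (hw : ∀ i, 0 < w i) {k : Fin d} (hk : ∀ i, w i ≤ w k)
    (i : Fin d) :
    wStar w i = w i - max (2 * w k - ∑ j, w j) 0 * (if i = k then 1 else 0) := by
  unfold wStar
  by_cases hik : i = k
  · rw [if_pos hik, hik]
    rcases le_or_gt (2 * w k) (∑ j, w j) with h | h
    · rw [if_pos h, max_eq_right (by linarith)]; ring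
    · rw [if_neg h.not_ge, max_eq_left (by linarith)]; ring
  -- For i ≠ k, 2w_i ≤ w_i + w_k ≤ S₁, so only a largest weight can be modified.
  · have h2 : w i + w k ≤ ∑ j, w j := by
      rw [← Finset.sum_pair hik]
      exact Finset.sum_le_sum_of_subset_of_nonneg (Finset.subset_univ _) fun j _ _ => (hw j).le
    rw [if_pos (by linarith [hk i]), if_neg hik]
    ring

end Combinatorics

/-! ### Bounds on the index and their equality cases -/

section Index

variable {d : ℕ} (H : Measure (Fin d → ℝ)) [IsProbabilityMeasure H]

theorem six_eq_average (hc : ∀ i, Continuous (cdf (marginal H i))) (w : Fin d → ℝ) :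
    six w H = (∑ p ∈ indexPairs d, w p.1 * w p.2 * pairRho H p.1 p.2) /
      ∑ p ∈ indexPairs d, w p.1 * w p.2 := by
  simp only [six, comonotonicPairRho_eq_one H hc, mul_one]

theorem six_le_one (hd : 2 ≤ d) {w : Fin d → ℝ} (hw : ∀ i, 0 < w i)
    (hc : ∀ i, Continuous (cdf (marginal H i))) : six w H ≤ 1 := by
  rw [six_eq_average H hc, div_le_one (sum_indexPairs_pos hd hw)]
  refine Finset.sum_le_sum fun p _ => mul_le_of_le_one_right (mul_pos (hw _) (hw _)).le ?_
  rw [pairRho_eq_scoreCov H hc]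
  linarith [scoreCov_le H hc p.1 p.2]

/-- The comparison with 1 is termwise, so equality of the sums forces equality in each term, and the
positive weights cancel. -/
theorem six_eq_one_iff (hd : 2 ≤ d) {w : Fin d → ℝ} (hw : ∀ i, 0 < w i)
    (hc : ∀ i, Continuous (cdf (marginal H i))) :
    six w H = 1 ↔
      ∀ i j, ∀ᵐ x ∂H, cdf (marginal H i) (x i) = cdf (marginal H j) (x j) := by
  rw [six_eq_average H hc, div_eq_one_iff_eq (sum_indexPairs_pos hd hw).ne',
    Finset.sum_eq_sum_iff_of_le fun p _ => mul_le_of_le_one_right (mul_pos (hw _) (hw _)).le (by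
      rw [pairRho_eq_scoreCov H hc]
      linarith [scoreCov_le H hc p.1 p.2])]
  have key : ∀ i j, w i * w j * pairRho H i j = w i * w j ↔
      ∀ᵐ x ∂H, cdf (marginal H i) (x i) = cdf (marginal H j) (x j) := by
    intro i j
    rw [← scoreCov_eq_iff H hc, pairRho_eq_scoreCov H hc,
      mul_eq_left₀ (mul_pos (hw i) (hw j)).ne']
    constructor <;> intro h <;> linarith
  constructor
  · intro h i j
    rcases lt_trichotomy i j with hij | rfl | hij
    · exact (key i j).1 (h (i, j) (by simp [indexPairs, hij]))
    · exact ae_of_all _ fun _ => rfl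
    · filter_upwards [(key j i).1 (h (j, i) (by simp [indexPairs, hij]))] with x hx
      exact hx.symm
  · intro h p _
    exact (key p.1 p.2).2 (h p.1 p.2)

/-- Forward: if x is in the support, almost every y with y_i < x_i has y_j ≤ x_j, whence F_i(x_i) ≤
F_j(x_j); exchange i and j. Backward: the equality of ranks is a closed condition, so it holds on
the whole support, and a pair of support points in opposite order would make a null open set have
positive mass. -/
theorem isComonotonic_iff (hc : ∀ i, Continuous (cdf (marginal H i))) :
    IsComonotonic H ↔
      ∀ i j, ∀ᵐ x ∂H, cdf (marginal H i) (x i) = cdf (marginal H j) (x j) := by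
  have hp := marginal_isProbability H
  have hsupp : ∀ᵐ x ∂H, x ∈ H.support := Measure.support_mem_ae
  constructor
  · intro hco
    have hle : ∀ x ∈ H.support, ∀ i j, cdf (marginal H i) (x i) ≤ cdf (marginal H j) (x j) := by
      intro x hx i j
      have := nullSingleton_of_continuous_cdf _ (hc i)
      have hI : Set.Iic (x i) =ᵐ[marginal H i] Set.Iio (x i) := Iio_ae_eq_Iic.symm
      rw [cdf_eq_real, cdf_eq_real, measureReal_congr hI, marginal, marginal,
        map_measureReal_apply (measurable_pi_apply i) measurableSet_Iio,
        map_measureReal_apply (measurable_pi_apply j) measurableSet_Iic]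
      refine ENNReal.toReal_mono (measure_ne_top _ _) (measure_mono_ae ?_)
      filter_upwards [hsupp] with y hy (hyi : y i < x i)
      change y j ≤ x j
      have h := hco x hx y hy i j
      nlinarith
    intro i j
    filter_upwards [hsupp] with x hx
    exact le_antisymm (hle x hx i j) (hle x hx j i)
  · intro h
    have hcl : ∀ i j, ∀ x ∈ H.support, cdf (marginal H i) (x i) = cdf (marginal H j) (x j) := by
      intro i j x hx
      have hclosed : IsClosed {x : Fin d → ℝ |
          cdf (marginal H i) (x i) = cdf (marginal H j) (x j)} :=
        isClosed_eq ((hc i).comp (continuous_apply i)) ((hc j).comp (continuous_apply j))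
      exact Measure.support_subset_of_isClosed hclosed (h i j) hx
    have hno : ∀ x ∈ H.support, ∀ y ∈ H.support, ∀ i j, x i < y i → y j < x j → False := by
      intro x hx y hy i j hi hj
      have hopen : IsOpen {z : Fin d → ℝ | z i < y i ∧ y j < z j} :=
        (isOpen_lt (continuous_apply i) continuous_const).inter
          (isOpen_lt continuous_const (continuous_apply j))
      have hpos : 0 < H {z : Fin d → ℝ | z i < y i ∧ y j < z j} :=
        (Measure.mem_support_iff_forall x).1 hx _ (hopen.mem_nhds ⟨hi, hj⟩)
      refine hpos.ne' (measure_eq_zero_iff_ae_notMem.2 ?_)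
      -- On this open set F_i(z_i) ≤ F_i(y_i) = F_j(y_j) ≤ F_j(z_j) = F_i(z_i), so the uniform
      -- variable F_i(z_i) hits the constant F_i(y_i), a null event.
      filter_upwards [h i j, ae_cdf_coord_ne H hc i (cdf (marginal H i) (y i))] with z hz hne hmem
      have h1 := monotone_cdf (marginal H i) (show z i ≤ y i from hmem.1.le)
      have h2 := monotone_cdf (marginal H j) (show y j ≤ z j from hmem.2.le)
      exact hne (le_antisymm h1 (by rw [hcl i j y hy, hz]; exact h2))
    intro x hx y hy i j
    by_contra hneg
    rcases mul_neg_iff.1 (not_le.1 hneg) with ⟨h1, h2⟩ | ⟨h1, h2⟩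
    · exact hno y hy x hx i j (by linarith) (by linarith)
    · exact hno x hx y hy i j (by linarith) (by linarith)

theorem six_eq_quadratic (hd : 2 ≤ d) {w : Fin d → ℝ} (hw : ∀ i, 0 < w i)
    (hc : ∀ i, Continuous (cdf (marginal H i))) :
    six w H = 1 / ((∑ i, w i) ^ 2 - ∑ i, w i ^ 2) *
      (12 * (∑ i, ∑ j, w i * w j * scoreCov H i j) - ∑ i, w i ^ 2) := by
  have hpos := sum_indexPairs_pos hd hw
  have h := sum_sum_eq_diag_add_indexPairs (fun i j => w i * w j * scoreCov H i j)
    fun i j => by rw [scoreCov_comm, mul_comm (w i)]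
  have e : ∑ p ∈ indexPairs d, w p.1 * w p.2 * pairRho H p.1 p.2 =
      12 * ∑ p ∈ indexPairs d, w p.1 * w p.2 * scoreCov H p.1 p.2 := by
    rw [Finset.mul_sum]
    exact Finset.sum_congr rfl fun p _ => by rw [pairRho_eq_scoreCov H hc]; ring
  have e2 : ∑ i, w i * w i * scoreCov H i i = (∑ i, w i ^ 2) / 12 := by
    rw [Finset.sum_div]
    exact Finset.sum_congr rfl fun i _ => by rw [scoreCov_self H hc]; ring
  rw [six_eq_average H hc, e, ← two_mul_sum_indexPairs, h, e2]
  field_simp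
  ring

/-- Splitting off `a = (2 w_k - ∑ w)₊` times the score of a largest weight, the quadratic form of the
scores is its value at `w*` plus the minimal variance, up to a nonnegative term. -/
theorem quadratic_eq_add {w : Fin d → ℝ} (hw : ∀ i, 0 < w i)
    (hc : ∀ i, Continuous (cdf (marginal H i))) {k : Fin d} (hk : ∀ i, w i ≤ w k) :
    ∑ i, ∑ j, w i * w j * scoreCov H i j =
      ∑ i, ∑ j, wStar w i * wStar w j * scoreCov H i j +
        2 * max (2 * w k - ∑ j, w j) 0 * (∑ i, wStar w i * scoreCov H i k) +
        1 / 12 * max (2 * w k - ∑ j, w j) 0 ^ 2 := by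
  set a := max (2 * w k - ∑ j, w j) 0
  have hs : ∀ i, w i = wStar w i + a * (if i = k then 1 else 0) := fun i => by
    rw [wStar_eq_sub hw hk]; ring
  have e : ∀ i j, w i * w j * scoreCov H i j = wStar w i * wStar w j * scoreCov H i j +
      a * (if j = k then wStar w i * scoreCov H i j else 0) +
      (if i = k then a * (wStar w j * scoreCov H i j) else 0) +
      (if i = k then (if j = k then a ^ 2 * scoreCov H i j else 0) else 0) := by
    intro i j
    rw [hs i, hs j]
    split_ifs <;> ring
  simp only [e, Finset.sum_add_distrib, ← Finset.mul_sum, Finset.sum_ite_eq', Finset.mem_univ,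
    if_true]
  have h3 : ∑ i, ∑ j, (if i = k then a * (wStar w j * scoreCov H i j) else 0) =
      a * ∑ j, wStar w j * scoreCov H j k := by
    rw [Finset.sum_comm]
    simp only [Finset.sum_ite_eq', Finset.mem_univ, if_true, Finset.mul_sum, scoreCov_comm H k]
  have h4 : ∑ i, ∑ j, (if i = k then (if j = k then a ^ 2 * scoreCov H i j else 0) else 0) =
      a ^ 2 * (1 / 12) := by
    rw [Finset.sum_comm]
    simp only [Finset.sum_ite_eq', Finset.mem_univ, if_true, scoreCov_self H hc]
  rw [h3, h4]
  ring

theorem excess_mul_nonneg {w : Fin d → ℝ} (hw : ∀ i, 0 < w i)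
    (hc : ∀ i, Continuous (cdf (marginal H i))) {k : Fin d} (hk : ∀ i, w i ≤ w k) :
    0 ≤ 2 * max (2 * w k - ∑ j, w j) 0 * (∑ i, wStar w i * scoreCov H i k) := by
  rcases le_or_gt (2 * w k - ∑ j, w j) 0 with h | h
  · rw [max_eq_right h]; simp
  · refine mul_nonneg (by positivity) ?_
    simp only [wStar_eq_sub hw hk, max_eq_left h.le]
    -- Adding 1/12 makes every covariance with Z_k nonnegative. Keeping only the summand i = k,
    -- which is w_k/6, already balances the subtracted terms S₁/12 and (2w_k - S₁)/12.
    have e : ∀ i, (w i - (2 * w k - ∑ j, w j) * (if i = k then 1 else 0)) * scoreCov H i k =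
        w i * (scoreCov H i k + 1 / 12) - w i / 12 -
          (if i = k then (2 * w k - ∑ j, w j) * scoreCov H i k else 0) := by
      intro i; split_ifs <;> ring
    simp only [e, Finset.sum_sub_distrib, Finset.sum_ite_eq', Finset.mem_univ, if_true,
      scoreCov_self H hc, ← Finset.sum_div]
    have h1 : w k * (scoreCov H k k + 1 / 12) ≤ ∑ i, w i * (scoreCov H i k + 1 / 12) :=
      Finset.single_le_sum (f := fun i => w i * (scoreCov H i k + 1 / 12))
        (fun i _ => mul_nonneg (hw i).le (by linarith [neg_le_scoreCov H hc i k]))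
        (Finset.mem_univ k)
    rw [scoreCov_self H hc] at h1
    linarith

theorem exists_max_weight (hd : 2 ≤ d) (w : Fin d → ℝ) :
    ∃ k, (∀ i, w i ≤ w k) ∧ ⨆ i, w i = w k := by
  have : Nonempty (Fin d) := ⟨⟨0, by omega⟩⟩
  obtain ⟨k, hk⟩ := Finite.exists_max w
  exact ⟨k, hk, le_antisymm (ciSup_le hk) (le_ciSup (Set.finite_range w).bddAbove k)⟩

theorem quadratic_nonneg (v : Fin d → ℝ) : 0 ≤ ∑ i, ∑ j, v i * v j * scoreCov H i j := by
  rw [← integral_sum_mul_sum]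
  exact integral_nonneg fun x => mul_self_nonneg _

theorem isWeightedCM_iff_ae (v : Fin d → ℝ) :
    IsWeightedCM v H ↔ ∀ᵐ x ∂H, ∑ i, v i * rankScore H i x = 0 := by
  have hm : MeasurableSet {x : Fin d → ℝ |
      ∑ i, v i * cdf (marginal H i) (x i) = (∑ i, v i) / 2} :=
    measurableSet_eq_fun (Finset.measurable_fun_sum _ fun i _ =>
      (measurable_cdf_coord H i).const_mul _) measurable_const
  rw [IsWeightedCM, ← mem_ae_iff_prob_eq_one hm]
  refine Filter.eventually_congr (ae_of_all _ fun x => ?_)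
  simp only [rankScore, mul_sub, Finset.sum_sub_distrib, ← Finset.sum_mul, sub_eq_zero]
  rw [div_eq_mul_one_div]

theorem quadratic_eq_zero_iff (v : Fin d → ℝ) :
    ∑ i, ∑ j, v i * v j * scoreCov H i j = 0 ↔ IsWeightedCM v H := by
  rw [isWeightedCM_iff_ae, ← integral_sum_mul_sum,
    integral_eq_zero_iff_of_nonneg (fun x => mul_self_nonneg _) (integrable_sum_mul_sum H v v)]
  refine Filter.eventually_congr (ae_of_all _ fun x => ?_)
  simp only [Pi.zero_apply, mul_self_eq_zero]

theorem lowerVar_le_quadratic (hd : 2 ≤ d) {w : Fin d → ℝ} (hw : ∀ i, 0 < w i)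
    (hc : ∀ i, Continuous (cdf (marginal H i))) :
    lowerVar w ≤ ∑ i, ∑ j, w i * w j * scoreCov H i j := by
  obtain ⟨k, hk, hsup⟩ := exists_max_weight hd w
  rw [quadratic_eq_add H hw hc hk, lowerVar, hsup]
  linarith [quadratic_nonneg H (wStar w), excess_mul_nonneg H hw hc hk]

theorem quadratic_eq_lowerVar_iff (hd : 2 ≤ d) {w : Fin d → ℝ} (hw : ∀ i, 0 < w i)
    (hc : ∀ i, Continuous (cdf (marginal H i))) :
    ∑ i, ∑ j, w i * w j * scoreCov H i j = lowerVar w ↔ IsWeightedCM (wStar w) H := by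
  obtain ⟨k, hk, hsup⟩ := exists_max_weight hd w
  rw [← quadratic_eq_zero_iff, quadratic_eq_add H hw hc hk, lowerVar, hsup]
  constructor
  · intro h
    linarith [quadratic_nonneg H (wStar w), excess_mul_nonneg H hw hc hk]
  · intro h
    -- The cross term is E[(∑ w*_i Z_i) Z_k], whose first factor vanishes almost surely.
    have hz : ∑ i, wStar w i * scoreCov H i k = 0 := by
      have hae := (isWeightedCM_iff_ae H _).1 ((quadratic_eq_zero_iff H (wStar w)).1 h)
      have hs : ∑ i, wStar w i * scoreCov H i k =
          ∫ x, (∑ i, wStar w i * rankScore H i x) * rankScore H k x ∂H := by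
        have := integral_sum_mul_sum H (wStar w) (Pi.single k 1)
        simpa [Pi.single_apply] using this.symm
      rw [hs]
      refine integral_eq_zero_of_ae ?_
      filter_upwards [hae] with x hx
      simp [hx]
    rw [h, hz]
    ring

end Index

/-! ### Hoeffding's formula and monotonicity in concordance -/

section Concordance

variable {d : ℕ} (H : Measure (Fin d → ℝ))

/-- The indicator of `{x_i ≤ s, x_j ≤ t}`. -/
noncomputable def orthantIndicator (i j : Fin d) (x : Fin d → ℝ) (p : ℝ × ℝ) : ℝ :=
  (if x i ≤ p.1 then 1 else 0) * (if x j ≤ p.2 then 1 else 0)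

theorem integral_orthantIndicator_right (i j : Fin d) (p : ℝ × ℝ) :
    ∫ x, orthantIndicator i j x p ∂H = H.real {x | x i ≤ p.1 ∧ x j ≤ p.2} := by
  have hm : MeasurableSet {x : Fin d → ℝ | x i ≤ p.1 ∧ x j ≤ p.2} :=
    (measurableSet_le (measurable_pi_apply i) measurable_const).inter
      (measurableSet_le (measurable_pi_apply j) measurable_const)
  have e : (fun x => orthantIndicator i j x p) =
      {x : Fin d → ℝ | x i ≤ p.1 ∧ x j ≤ p.2}.indicator fun _ => (1 : ℝ) := by
    funext x
    simp only [orthantIndicator, Set.indicator_apply, Set.mem_ofPred_eq, ite_and]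
    split_ifs <;> simp
  rw [e, integral_indicator_const _ hm]
  simp

variable [IsProbabilityMeasure H]

/-- The joint distribution function of two coordinates, as a limit of `jointCDF`. -/
theorem tendsto_jointCDF_pair {i j : Fin d} (hij : i ≠ j) (s t : ℝ) :
    Filter.Tendsto (fun n : ℕ => jointCDF H fun k => if k = i then s else if k = j then t else n)
      Filter.atTop (nhds (H.real {x | x i ≤ s ∧ x j ≤ t})) := by
  have hu : {x : Fin d → ℝ | x i ≤ s ∧ x j ≤ t} =
      -- The other coordinates are capped at n; being finitely many, they all satisfy the cap for
      -- large n.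
      ⋃ n : ℕ, {x | ∀ k, x k ≤ if k = i then s else if k = j then t else n} := by
    ext x
    simp only [Set.mem_iUnion, Set.mem_ofPred_eq]
    constructor
    · rintro ⟨h1, h2⟩
      obtain ⟨b, hb⟩ := (Set.finite_range x).bddAbove
      obtain ⟨n, hn⟩ := exists_nat_ge b
      refine ⟨n, fun k => ?_⟩
      split_ifs with h h'
      · rwa [h]
      · rwa [h']
      · exact (hb ⟨k, rfl⟩).trans hn
    · rintro ⟨n, hn⟩
      exact ⟨by simpa using hn i, by simpa [hij.symm] using hn j⟩
  rw [hu]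
  refine (ENNReal.tendsto_toReal (measure_ne_top _ _)).comp (tendsto_measure_iUnion_atTop ?_)
  intro m n hmn x hx k
  refine (hx k).trans ?_
  dsimp only
  split_ifs
  · exact le_rfl
  · exact le_rfl
  · exact_mod_cast hmn

theorem integrable_orthantIndicator (i j : Fin d) (m : Measure (ℝ × ℝ)) [IsProbabilityMeasure m] :
    Integrable (Function.uncurry (orthantIndicator i j)) (H.prod m) := by
  have h1 : Measurable fun q : (Fin d → ℝ) × (ℝ × ℝ) => if q.1 i ≤ q.2.1 then (1 : ℝ) else 0 :=
    Measurable.ite (measurableSet_le (by fun_prop) (by fun_prop)) measurable_const measurable_const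
  have h2 : Measurable fun q : (Fin d → ℝ) × (ℝ × ℝ) => if q.1 j ≤ q.2.2 then (1 : ℝ) else 0 :=
    Measurable.ite (measurableSet_le (by fun_prop) (by fun_prop)) measurable_const measurable_const
  refine Integrable.of_bound (h1.mul h2).aestronglyMeasurable 1 (ae_of_all _ fun q => ?_)
  simp only [Function.uncurry, orthantIndicator]
  split_ifs <;> simp

theorem integral_le_indicator (μ : Measure ℝ) [IsProbabilityMeasure μ] (hμ : Continuous (cdf μ))
    (z : ℝ) : ∫ t, (if z ≤ t then (1 : ℝ) else 0) ∂μ = 1 - cdf μ z := by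
  have := nullSingleton_of_continuous_cdf _ hμ
  have e : (fun t : ℝ => if z ≤ t then (1 : ℝ) else 0) = (Set.Ici z).indicator fun _ => 1 := by
    funext t; simp [Set.indicator_apply]
  have hI : Set.Ici z =ᵐ[μ] Set.Ioi z := Ioi_ae_eq_Ici.symm
  rw [e, integral_indicator_const _ measurableSet_Ici, measureReal_congr hI, cdf_eq_real,
    ← Set.compl_Iic, probReal_compl_eq_one_sub measurableSet_Iic]
  simp

/-- Averaging over independent thresholds S ~ F_i and T ~ F_j gives P(S ≥ x_i) P(T ≥ x_j), and P(S ≥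
x_i) = 1 - F_i(x_i). -/
theorem integral_orthantIndicator_left (hc : ∀ i, Continuous (cdf (marginal H i))) (i j : Fin d)
    (x : Fin d → ℝ) :
    ∫ p, orthantIndicator i j x p ∂((marginal H i).prod (marginal H j)) =
      (1 / 2 - rankScore H i x) * (1 / 2 - rankScore H j x) := by
  have := marginal_isProbability H
  unfold orthantIndicator
  rw [integral_prod_mul (fun s => if x i ≤ s then (1 : ℝ) else 0)
    (fun t => if x j ≤ t then (1 : ℝ) else 0), integral_le_indicator _ (hc i),
    integral_le_indicator _ (hc j), rankScore, rankScore]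
  ring

/-- Hoeffding's formula for the covariance of the ranks. -/
theorem scoreCov_eq_integral_cdf (hc : ∀ i, Continuous (cdf (marginal H i))) (i j : Fin d) :
    scoreCov H i j = ∫ p, H.real {x | x i ≤ p.1 ∧ x j ≤ p.2}
      ∂((marginal H i).prod (marginal H j)) - 1 / 4 := by
  have := marginal_isProbability H
  have h := integral_integral_swap
    (integrable_orthantIndicator H i j ((marginal H i).prod (marginal H j)))
  simp only [integral_orthantIndicator_left H hc, integral_orthantIndicator_right] at h
  -- After Fubini the linear terms integrate to zero, leaving 1/4 + E[Z_i Z_j].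
  have e : ∀ x, (1 / 2 - rankScore H i x) * (1 / 2 - rankScore H j x) =
      1 / 4 - 1 / 2 * rankScore H i x - 1 / 2 * rankScore H j x +
        rankScore H i x * rankScore H j x := fun x => by ring
  have hi := (integrable_rankScore H i).const_mul (1 / 2)
  have hj := (integrable_rankScore H j).const_mul (1 / 2)
  rw [← h]
  simp only [e]
  have h1 : Integrable (fun x => 1 / 4 - 1 / 2 * rankScore H i x) H := (integrable_const _).sub hi
  have h2 : Integrable (fun x => 1 / 4 - 1 / 2 * rankScore H i x - 1 / 2 * rankScore H j x) H :=
    h1.sub hj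
  rw [integral_add h2 (integrable_rankScore_mul H i j), integral_sub h1 hj, integral_sub (integrable_const _) hi,
    integral_const_mul, integral_const_mul, integral_rankScore H hc, integral_rankScore H hc]
  simp [scoreCov]

theorem integrable_pair_cdf (i j : Fin d) (m : Measure (ℝ × ℝ)) [IsProbabilityMeasure m] :
    Integrable (fun p : ℝ × ℝ => H.real {x | x i ≤ p.1 ∧ x j ≤ p.2}) m := by
  have h := (integrable_orthantIndicator H i j m).integral_prod_right
  simpa only [Function.uncurry, integral_orthantIndicator_right] using h

theorem scoreCov_mono (H' : Measure (Fin d → ℝ)) [IsProbabilityMeasure H']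
    (hc : ∀ i, Continuous (cdf (marginal H i))) (hm : ∀ i, marginal H' i = marginal H i)
    (hle : ∀ x, jointCDF H x ≤ jointCDF H' x) {i j : Fin d} (hij : i ≠ j) :
    scoreCov H i j ≤ scoreCov H' i j := by
  have := marginal_isProbability H
  rw [scoreCov_eq_integral_cdf H hc, scoreCov_eq_integral_cdf H' fun i => by rw [hm]; exact hc i,
    hm, hm]
  refine sub_le_sub_right (integral_mono (integrable_pair_cdf H i j _)
    (integrable_pair_cdf H' i j _) fun p => ?_) _
  exact le_of_tendsto_of_tendsto' (tendsto_jointCDF_pair H hij p.1 p.2)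
    (tendsto_jointCDF_pair H' hij p.1 p.2) fun n => hle _

theorem six_mono (H' : Measure (Fin d → ℝ)) [IsProbabilityMeasure H'] (hd : 2 ≤ d)
    {w : Fin d → ℝ} (hw : ∀ i, 0 < w i)
    (hc : ∀ i, Continuous (cdf (marginal H i))) (hm : ∀ i, marginal H' i = marginal H i)
    (hle : ∀ x, jointCDF H x ≤ jointCDF H' x) : six w H ≤ six w H' := by
  have hc' : ∀ i, Continuous (cdf (marginal H' i)) := fun i => by rw [hm]; exact hc i
  rw [six_eq_average H hc, six_eq_average H' hc']
  refine div_le_div_of_nonneg_right (Finset.sum_le_sum fun p hp => ?_) (sum_indexPairs_pos hd hw).le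
  rw [pairRho_eq_scoreCov H hc, pairRho_eq_scoreCov H' hc']
  have hlt : p.1 < p.2 := (Finset.mem_filter.1 hp).2
  have := scoreCov_mono H H' hc hm hle hlt.ne
  exact mul_le_mul_of_nonneg_left (by linarith) (mul_pos (hw _) (hw _)).le

end Concordance

end HerdBehavior

/-! ### Assembly of the theorem -/

theorem theorem6p1 {d : ℕ} (hd : 2 ≤ d) (w : Fin d → ℝ) (hw : ∀ i, 0 < w i)
    (S₁ S₂ : ℝ) (hS₁ : S₁ = ∑ i, w i) (hS₂ : S₂ = ∑ i, w i ^ 2)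
    (ν : Fin d → Measure ℝ) [∀ i, IsProbabilityMeasure (ν i)]
    (hν : ∀ i, Continuous (ProbabilityTheory.cdf (ν i)))
    (C C' H H' : Measure (Fin d → ℝ))
    (hC : C ∈ HerdBehavior.copulas d) (hC' : C' ∈ HerdBehavior.copulas d)
    (hH : H ∈ HerdBehavior.frechetSpace ν) (hH' : H' ∈ HerdBehavior.frechetSpace ν)
    (hHC : HerdBehavior.HasCopula ν H C) (hHC' : HerdBehavior.HasCopula ν H' C') :
    -- SIX is the weighted average of the pairwise rhos
    (HerdBehavior.six w H =
      (∑ p ∈ HerdBehavior.indexPairs d, w p.1 * w p.2 * HerdBehavior.pairRho H p.1 p.2) /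
        (∑ p ∈ HerdBehavior.indexPairs d, w p.1 * w p.2)) ∧
    -- (i) monotonicity
    (HerdBehavior.ConcordanceLE C C' → HerdBehavior.six w H ≤ HerdBehavior.six w H') ∧
    -- (ii) bounds
    (1 / (S₁ ^ 2 - S₂) * (12 * HerdBehavior.lowerVar w - S₂) ≤ HerdBehavior.six w H ∧
      HerdBehavior.six w H ≤ 1) ∧
    -- (iii) the upper bound
    (HerdBehavior.six w H = 1 ↔ HerdBehavior.IsComonotonic H) ∧
    -- (iv) the lower bound
    (HerdBehavior.six w H = 1 / (S₁ ^ 2 - S₂) * (12 * HerdBehavior.lowerVar w - S₂) ↔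
      HerdBehavior.IsWeightedCM (HerdBehavior.wStar w) H) := by
  obtain ⟨hP, hm⟩ := hH
  obtain ⟨hP', hm'⟩ := hH'
  have hc : ∀ i, Continuous (ProbabilityTheory.cdf (HerdBehavior.marginal H i)) := fun i => by
    rw [hm]; exact hν i
  have hpos : 0 < 1 / (S₁ ^ 2 - S₂) := by
    rw [hS₁, hS₂, ← HerdBehavior.two_mul_sum_indexPairs]
    have := HerdBehavior.sum_indexPairs_pos hd hw
    positivity
  have hq := HerdBehavior.six_eq_quadratic H hd hw hc
  rw [← hS₁, ← hS₂] at hq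
  refine ⟨HerdBehavior.six_eq_average H hc w, fun hle => ?_, ⟨?_,
    HerdBehavior.six_le_one H hd hw hc⟩, ?_, ?_⟩
  · refine HerdBehavior.six_mono H H' hd hw hc (fun i => by rw [hm, hm']) fun x => ?_
    -- Both laws evaluate their copulas at the same point (F_i(x_i)), so the comparison of C and C*
    -- passes to H and H*.
    rw [hHC, hHC']
    exact hle.1 _
  · rw [hq]
    exact mul_le_mul_of_nonneg_left
      (by linarith [HerdBehavior.lowerVar_le_quadratic H hd hw hc]) hpos.le
  · rw [HerdBehavior.six_eq_one_iff H hd hw hc, HerdBehavior.isComonotonic_iff H hc]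
  · rw [← HerdBehavior.quadratic_eq_lowerVar_iff H hd hw hc, hq, mul_right_inj' hpos.ne']
    constructor <;> intro h <;> linarith
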